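/- **Conventions.** Let $n\ge 0$. A simplicial complex $\mathcal K$ of dimension $n$ is a nonempty collection of finite nonempty sets (its faces), closed under taking nonempty subsets, such that every face is contained in a face with exactly $n+1$ elements and no face has more than $n+1$ elements; its vertices are the elements of its faces. A set of $k+1$ vertices that is a face is a $k$-face (the empty set counts as the unique $(-1)$-face). We say that $\mathcal K$ is *of type $\{3,4\}$* if * (closed) every $(n-1)$-face is contained in exactly two $n$-faces; * (strongly connected) any two $n$-faces are joined by a chain of $n$-faces in which consecutive ones share an $(n-1)$-face; * every $(n-2)$-face is contained in exactly $3$ or exactly $4$ $n$-faces, i.e. its link is a cycle of length $3$ or $4$ (it is not required that both values occur). $\mathrm{Aut}(\mathcal K)$ is the group of permutations of the vertex set that preserve the set of faces. A *convex polytopal realization* of $\mathcal K$ (whose vertex set $V$ is then finite) is an injective map $\varphi:V\to\mathbb R^{n+1}$ such that $\mathcal P=\mathrm{conv}\,\varphi(V)$ is a full-dimensional convex polytope with vertex set $\varphi(V)$, $\varphi(F)$ is affinely independent for every face $F$ of $\mathcal K$, and the nonempty proper faces of $\mathcal P$ are exactly the simplices $\mathrm{conv}\,\varphi(F)$ with $F$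 a face of $\mathcal K$. **Proposition 2.6.** Every simplicial complex $\mathcal K$ of dimension $n$ and type $\{3,4\}$ has a convex polytopal realization $\varphi:V\to\mathbb R^{n+1}$, with polytope $\mathcal P=\mathrm{conv}\,\varphi(V)$, whose group of isometries $\mathrm{Isom}(\mathcal P)=\{g\in\mathrm{Isom}(\mathbb R^{n+1}) : g(\mathcal P)=\mathcal P\}$ coincides with $\mathrm{Aut}(\mathcal K)$: there is a group isomorphism $\Phi:\mathrm{Isom}(\mathcal P)\to\mathrm{Aut}(\mathcal K)$ with $g(\varphi(v))=\varphi(\Phi(g)(v))$ for all $g\in\mathrm{Isom}(\mathcal P)$ and $v\in V$. Moreover $\mathcal P$ can be chosen so that the origin is interior to $\mathcal P$ and the polar dual $\{y : \langle x,y\rangle\le 1 \text{ for all } x\in \mathcal P\}$ is, up to a linear isometry, an orthogonal product $\Delta_1\times\dots\times\Delta_t\subset\mathbb R^{m_1}\times\dots\times\mathbb R^{m_t}$ of regular simplices $\Delta_i$ of dimension $m_i\ge 1$. -/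

import Mathlib

/-! ### Abstract simplicial complexes of type `{3,4}` -/

/-- `S` is a face of dimension `n` (it has `n + 1` vertices) of the simplicial complex `K`. -/
def IsTopFace {V : Type*} (K : AbstractSimplicialComplex V) (n : ℕ) (S : Finset V) : Prop :=
  S ∈ K.faces ∧ S.card = n + 1

/-- `K` is a (nonempty) simplicial complex of pure dimension `n`: no face has more than `n + 1`
vertices, and every face lies in a face with exactly `n + 1` vertices. -/
structure IsPureOfDim {V : Type*} (K : AbstractSimplicialComplex V) (n : ℕ) : Prop where
  nonempty : K.faces.Nonempty
  card_le : ∀ S ∈ K.faces, S.card ≤ n + 1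
  exists_top : ∀ S ∈ K.faces, ∃ T, IsTopFace K n T ∧ S ⊆ T

/-- The number of `n`-faces of `K` that contain `F` (and `0` if there are infinitely many).
For an `(n-2)`-face `F` of a closed complex the sets `T \ F`, with `T` an `n`-face containing `F`,
are the edges of the link of `F`, so this number is the length of the link. -/
noncomputable def numTopFaces {V : Type*} (K : AbstractSimplicialComplex V) (n : ℕ)
    (F : Finset V) : ℕ :=
  {T : Finset V | IsTopFace K n T ∧ F ⊆ T}.ncard

/-- Every `(n-1)`-face of `K` lies in exactly two `n`-faces. -/
def IsClosedComplex {V : Type*} (K : AbstractSimplicialComplex V) (n : ℕ) : Prop :=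
  ∀ F S : Finset V, IsTopFace K n S → F ⊆ S → F.card = n → numTopFaces K n F = 2

/-- Any two `n`-faces are joined by a chain of `n`-faces in which consecutive ones share an
`(n-1)`-face. -/
def IsStronglyConnected {V : Type*} (K : AbstractSimplicialComplex V) (n : ℕ) : Prop :=
  ∀ S T : Finset V, IsTopFace K n S → IsTopFace K n T →
    Relation.ReflTransGen
      (fun A B : Finset V => IsTopFace K n A ∧ IsTopFace K n B ∧
        ∃ F : Finset V, F ⊆ A ∧ F ⊆ B ∧ F.card = n) S T

/-- `K` is an `n`-dimensional closed, strongly connected simplicial complex in which the link of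
every `(n-2)`-face has length `3` or `4`.  An `(n-2)`-face has `n - 1` vertices; for `n = 1` it is
the empty face, whose link is `K` itself. -/
structure IsType34 {V : Type*} (K : AbstractSimplicialComplex V) (n : ℕ) : Prop where
  pure : IsPureOfDim K n
  closed : IsClosedComplex K n
  connected : IsStronglyConnected K n
  link_length : ∀ F S : Finset V, IsTopFace K n S → F ⊆ S → F.card + 1 = n →
    numTopFaces K n F = 3 ∨ numTopFaces K n F = 4

/-- The automorphism group of `K`: the permutations of the vertices preserving the set of faces. -/
def autGroup {V : Type*} (K : AbstractSimplicialComplex V) : Subgroup (Equiv.Perm V) where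
  carrier := {σ | ∀ S : Finset V, S.map σ.toEmbedding ∈ K.faces ↔ S ∈ K.faces}
  one_mem' := by
    intro S
    have h : S.map (1 : Equiv.Perm V).toEmbedding = S := by
      ext x; simp; rfl
    rw [h]
  mul_mem' := by
    intro σ τ hσ hτ S
    have h : S.map (σ * τ).toEmbedding = (S.map τ.toEmbedding).map σ.toEmbedding := by
      rw [Finset.map_map]; rfl
    rw [h, hσ, hτ]
  inv_mem' := by
    intro σ hσ S
    have h : (S.map (σ⁻¹).toEmbedding).map σ.toEmbedding = S := by
      rw [Finset.map_map]
      ext x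
      simp
    rw [← hσ, h]

/-! ### Convex polytopes -/

/-- The Euclidean isometries (of the whole space `E`) that map `P` onto itself. -/
def isometryGroupOf {E : Type*} [PseudoEMetricSpace E] (P : Set E) : Subgroup (E ≃ᵢ E) where
  carrier := {g | g '' P = P}
  one_mem' := Set.image_id P
  mul_mem' := by
    intro g h hg hh
    change (fun x => g (h x)) '' P = P
    rw [← Set.image_image g h, hh, hg]
  inv_mem' := by
    intro g hg
    change g.symm '' P = P
    have hg' : g '' P = P := hg
    conv_lhs => rw [← hg']
    rw [Set.image_image]
    simp

/-- The convex polytope spanned by the points `φ v` realizes `K`: `K` has finitely many vertices,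
`φ` maps them bijectively onto the vertices of a full-dimensional convex polytope, the faces of `K`
are mapped to affinely independent sets, and the nonempty proper faces of the polytope are exactly
the simplices spanned by the (images of the) faces of `K`. -/
structure IsPolytopalRealization {V E : Type*} [NormedAddCommGroup E] [InnerProductSpace ℝ E]
    (K : AbstractSimplicialComplex V) (φ : V → E) : Prop where
  finite : Finite V
  injective : Function.Injective φ
  full_dim : (interior (convexHull ℝ (Set.range φ))).Nonempty
  vertices : (convexHull ℝ (Set.range φ)).extremePoints ℝ = Set.range φ
  simplices : ∀ F ∈ K.faces, AffineIndependent ℝ (fun v : F => φ v)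
  faces : ∀ B : Set E,
    (B.Nonempty ∧ B ≠ convexHull ℝ (Set.range φ) ∧ IsExposed ℝ (convexHull ℝ (Set.range φ)) B) ↔
      ∃ F ∈ K.faces, B = convexHull ℝ (φ '' (F : Set V))

/-- The polar dual of `P` with respect to the origin. -/
def polarDual {E : Type*} [NormedAddCommGroup E] [InnerProductSpace ℝ E] (P : Set E) : Set E :=
  {y | ∀ x ∈ P, inner ℝ x y ≤ 1}

/-- The origin is interior to `P`, and the polar dual of `P` is, up to a linear isometry, an
orthogonal product of regular simplices of positive dimensions `m i`. -/
def IsPolarDualOfSimplexProduct {E : Type*} [NormedAddCommGroup E] [InnerProductSpace ℝ E]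
    (P : Set E) : Prop :=
  (0 : E) ∈ interior P ∧
    ∃ (t : ℕ) (m : Fin t → ℕ)
      (Δ : ∀ i, Affine.Simplex ℝ (EuclideanSpace ℝ (Fin (m i))) (m i))
      (e : E ≃ₗᵢ[ℝ] PiLp 2 (fun i => EuclideanSpace ℝ (Fin (m i)))),
      (∀ i, 0 < m i ∧ (Δ i).Equilateral) ∧
        e '' polarDual P = {x | ∀ i, x i ∈ convexHull ℝ (Set.range (Δ i).points)}

/-!
Every vertex `v` of a facet `T` is exchanged for another vertex when one passes to the facet on the
other side of the ridge opposite to `v`; put two vertices of `T` into the same block if they are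
exchanged for the same vertex, together with that vertex. Since the links of codimension two have
length three or four, these blocks do not change when one moves to an adjacent facet, so by strong
connectedness the vertex set is partitioned into blocks of which every facet misses exactly one
vertex each: `K` is a join of boundaries of simplices. Projecting the standard basis of `ℝ^V`
orthogonally to the space of functions that sum to zero over every block realizes `K`. The polar
dual is the set of functions in this space that are at most `1` everywhere, a product of regular
simplices. Automorphisms of `K` preserve the minimal non-faces, which are the blocks, hence permute
the basis vectors compatibly with the projection and extend to isometries.
-/

section Combinatorics

variable {V ι : Type*} {K : AbstractSimplicialComplex V} {n : ℕ}

theorem mem_faces_of_subset {F T : Finset V} (hT : T ∈ K.faces) (hF : F.Nonempty) (h : F ⊆ T) :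
    F ∈ K.faces :=
  (K.isRelLowerSet_faces hT).2 h hF

theorem IsType34.eq_of_facets_around (hK : IsType34 K n) {F : Finset V} (hF : F.card + 1 = n)
    {s : Finset (Finset V)} (hs : ∀ T ∈ s, IsTopFace K n T ∧ F ⊆ T) (hcard : s.card = 3)
    {A B : Finset V} (hA : IsTopFace K n A ∧ F ⊆ A) (hB : IsTopFace K n B ∧ F ⊆ B)
    (hAs : A ∉ s) (hBs : B ∉ s) : A = B := by
  classical
  by_contra hAB
  have hlink := hK.link_length F A hA.1 hA.2 hF
  have hfin : {T | IsTopFace K n T ∧ F ⊆ T}.Finite :=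
    Set.finite_of_ncard_ne_zero (by change numTopFaces K n F ≠ 0; omega)
  have hsub : (↑(insert A (insert B s)) : Set (Finset V)) ⊆ {T | IsTopFace K n T ∧ F ⊆ T} := by
    intro T hT
    grind
  have hle : _ ≤ numTopFaces K n F := Set.ncard_le_ncard hsub hfin
  rw [Set.ncard_coe_finset, Finset.card_insert_of_notMem (by grind),
    Finset.card_insert_of_notMem hBs] at hle
  omega

variable [DecidableEq V]

theorem IsTopFace.exists_eq_insert_erase {T A : Finset V} (hT : IsTopFace K n T)
    (hA : IsTopFace K n A) {v : V} (hv : v ∈ T) (h : T.erase v ⊆ A) (hne : A ≠ T) :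
    ∃ w ∉ T, A = insert w (T.erase v) := by
  obtain ⟨w, hw, rfl⟩ := Finset.exists_eq_insert_iff.2
    ⟨h, by rw [Finset.card_erase_add_one hv, hT.2, hA.2]⟩
  exact ⟨w, by grind, rfl⟩

theorem IsClosedComplex.exists_neighbour (hK : IsClosedComplex K n) {T : Finset V}
    (hT : IsTopFace K n T) {v : V} (hv : v ∈ T) :
    ∃ w ∉ T, ∀ A, IsTopFace K n A ∧ T.erase v ⊆ A ↔ A = T ∨ A = insert w (T.erase v) := by
  have hcard : (T.erase v).card = n := by rw [Finset.card_erase_of_mem hv, hT.2]; rfl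
  obtain ⟨B, hBT, hB⟩ : ∃ B ≠ T, {A | IsTopFace K n A ∧ T.erase v ⊆ A} = {T, B} := by
    obtain ⟨A, B, hAB, h⟩ := Set.ncard_eq_two.1 (hK _ _ hT (T.erase_subset v) hcard)
    obtain rfl | rfl : T = A ∨ T = B := h.subset ⟨hT, T.erase_subset v⟩
    · exact ⟨B, hAB.symm, h⟩
    · exact ⟨A, hAB, h.trans (Set.pair_comm A T)⟩
  have hBF : IsTopFace K n B ∧ T.erase v ⊆ B := hB.superset (Set.mem_insert_of_mem T rfl)
  obtain ⟨w, hw, rfl⟩ := hT.exists_eq_insert_erase hBF.1 hv hBF.2 hBT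
  exact ⟨w, hw, fun A => Set.ext_iff.1 hB A⟩

theorem IsType34.square (hK : IsType34 K n) {T : Finset V} (hT : IsTopFace K n T) {u v w x : V}
    (hu : u ∈ T) (hv : v ∈ T) (huv : u ≠ v) (hw : w ∉ T) (hx : x ∉ T) (hwx : w ≠ x)
    (hTv : IsTopFace K n (insert w (T.erase v))) (hTu : IsTopFace K n (insert x (T.erase u))) :
    IsTopFace K n (insert w (insert x ((T.erase u).erase v))) := by
  set F := (T.erase u).erase v
  have hFcard : F.card + 1 = n := by
    have h₁ : F.card + 1 = (T.erase u).card :=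
      Finset.card_erase_add_one (Finset.mem_erase.2 ⟨huv.symm, hv⟩)
    have h₂ := Finset.card_erase_add_one hu
    have h₃ := hT.2
    omega
  obtain ⟨y, hy, hy'⟩ := hK.closed.exists_neighbour hTv (v := u) (by grind)
  obtain ⟨z, hz, hz'⟩ := hK.closed.exists_neighbour hTu (v := v) (by grind)
  have hTy := ((hy' _).2 (Or.inr rfl)).1
  have hTz := ((hz' _).2 (Or.inr rfl)).1
  have hcard : ({T, insert w (T.erase v), insert x (T.erase u)} : Finset (Finset V)).card = 3 := by
    refine Finset.card_eq_three.2 ⟨_, _, _, ?_, ?_, ?_, rfl⟩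
    · exact (ne_of_mem_of_not_mem' (Finset.mem_insert_self w _) hw).symm
    · exact (ne_of_mem_of_not_mem' (Finset.mem_insert_self x _) hx).symm
    · exact ne_of_mem_of_not_mem' (Finset.mem_insert_self w _) (by grind)
  -- The facets beyond the edges `u w` and `v x` of the link of `F` must coincide.
  have heq := hK.eq_of_facets_around hFcard (by grind) hcard
    (A := insert y ((insert w (T.erase v)).erase u))
    (B := insert z ((insert x (T.erase u)).erase v))
    ⟨hTy, by grind⟩ ⟨hTz, by grind⟩ (by grind) (by grind)
  have hyx : y = x := by grind
  convert hTy using 1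
  grind

/-- The vertices in `U` are partitioned into blocks, labelled by `β`, such that the facet `T`
misses at most one vertex of each block and the facet adjacent to `T` opposite to any of its
vertices is obtained by exchanging this vertex for the missing vertex of its block. -/
structure IsCompatible (K : AbstractSimplicialComplex V) (n : ℕ) (U : Finset V) (β : V → ι)
    (T : Finset V) : Prop where
  facet : IsTopFace K n T
  subset : T ⊆ U
  injOn : Set.InjOn β ↑(U \ T)
  exchange : ∀ v ∈ T, ∃ w ∈ U \ T, β w = β v ∧ IsTopFace K n (insert w (T.erase v))

theorem IsClosedComplex.exists_isCompatible (hK : IsClosedComplex K n) {T : Finset V}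
    (hT : IsTopFace K n T) : ∃ (U : Finset V) (β : V → V), IsCompatible K n U β T := by
  have hω : ∀ v, ∃ w, v ∈ T → w ∉ T ∧ IsTopFace K n (insert w (T.erase v)) := by
    intro v
    by_cases hv : v ∈ T
    · obtain ⟨w, hw, h⟩ := hK.exists_neighbour hT hv
      exact ⟨w, fun _ => ⟨hw, ((h _).2 (Or.inr rfl)).1⟩⟩
    · exact ⟨v, fun h => (hv h).elim⟩
  choose ω hω using hω
  refine ⟨T ∪ T.image ω, fun v => if v ∈ T then ω v else v, hT, Finset.subset_union_left,
    fun a ha b hb h => ?_, fun v hv => ⟨ω v, ?_, ?_, (hω v hv).2⟩⟩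
  · grind
  · grind
  · grind

namespace IsCompatible

variable {U T : Finset V} {β : V → ι}

theorem flip (h : IsCompatible K n U β T) (hK : IsType34 K n) {v w : V} (hv : v ∈ T)
    (hw : w ∈ U \ T) (hwv : β w = β v) : IsCompatible K n U β (insert w (T.erase v)) := by
  obtain ⟨hwU, hwT⟩ := Finset.mem_sdiff.1 hw
  have opposite : ∀ u ∈ T, β u = β v → IsTopFace K n (insert w (T.erase u)) := by
    intro u hu huv
    obtain ⟨x, hx, hxu, hTx⟩ := h.exchange u hu
    rwa [h.injOn hw hx (by rw [hwv, hxu, huv])]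
  have hvmem : v ∈ U \ insert w (T.erase v) := by grind [h.subset hv]
  refine ⟨opposite v hv rfl, by grind [h.subset], ?_, fun u hu => ?_⟩
  · intro a ha b hb hab
    have hinj := @h.injOn
    grind [Set.InjOn]
  · obtain rfl | hu := Finset.mem_insert.1 hu
    · exact ⟨v, hvmem, hwv.symm, by
        rw [Finset.erase_insert (by grind), Finset.insert_erase hv]; exact h.facet⟩
    · obtain ⟨huv, huT⟩ := Finset.mem_erase.1 hu
      by_cases hb : β u = β v
      · refine ⟨v, hvmem, hb.symm, ?_⟩
        convert opposite u huT hb using 1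
        grind
      · obtain ⟨x, hx, hxu, hTx⟩ := h.exchange u huT
        have hxw : x ≠ w := by
          rintro rfl
          exact hb (hxu.symm.trans hwv)
        refine ⟨x, by grind, hxu, ?_⟩
        convert hK.square h.facet hv huT huv.symm (Finset.mem_sdiff.1 hx).2 hwT hxw hTx
          (opposite v hv rfl) using 1
        grind

theorem of_isTopFace (h : IsCompatible K n U β T) (hK : IsType34 K n) {A : Finset V}
    (hA : IsTopFace K n A) : IsCompatible K n U β A := by
  induction hK.connected T A h.facet hA with
  | refl => exact h
  | @tail A B _ hAB ih =>
    obtain ⟨hA, hB, F, hFA, hFB, hF⟩ := hAB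
    have hAcomp := ih hA
    obtain ⟨v, hv, rfl⟩ := Finset.exists_eq_insert_iff.2 ⟨hFA, by rw [hF, hA.2]⟩
    obtain ⟨w, hw, hwv, hTw⟩ := hAcomp.exchange v (F.mem_insert_self v)
    obtain ⟨x, -, hx⟩ := hK.closed.exists_neighbour hA (F.mem_insert_self v)
    rw [Finset.erase_insert hv] at hx hTw
    obtain rfl | hB' := (hx B).1 ⟨hB, hFB⟩
    · exact hAcomp
    · obtain hAw | hxw := (hx _).1 ⟨hTw, Finset.subset_insert w F⟩
      · grind
      · have hflip := hAcomp.flip hK (F.mem_insert_self v) hw hwv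
        rwa [Finset.erase_insert hv, hxw, ← hB'] at hflip

theorem mem (h : IsCompatible K n U β T) (hK : IsType34 K n) (v : V) : v ∈ U := by
  obtain ⟨A, hA, hvA⟩ := hK.pure.exists_top _ (K.singleton_mem v)
  exact (h.of_isTopFace hK hA).subset (hvA (Finset.mem_singleton_self v))

theorem exists_superset (h : IsCompatible K n U β T) (hK : IsType34 K n) {F : Finset V}
    (hF : ∀ v, ∃ u ∉ F, β u = β v) : ∃ A, IsCompatible K n U β A ∧ F ⊆ A := by
  induction F using Finset.induction_on with
  | empty => exact ⟨T, h, Finset.empty_subset T⟩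
  | insert a F _ ih =>
    obtain ⟨A, hA, hFA⟩ := ih fun v => by
      obtain ⟨u, hu, huv⟩ := hF v
      exact ⟨u, fun h => hu (Finset.mem_insert_of_mem h), huv⟩
    by_cases haA : a ∈ A
    · exact ⟨A, hA, Finset.insert_subset haA hFA⟩
    · obtain ⟨u, hu, hua⟩ := hF a
      have haU : a ∈ U \ A := Finset.mem_sdiff.2 ⟨h.mem hK a, haA⟩
      have huA : u ∈ A := by
        by_contra huA
        have := hA.injOn (Finset.mem_sdiff.2 ⟨h.mem hK u, huA⟩) haU hua
        grind
      exact ⟨_, hA.flip hK huA haU hua.symm, by grind⟩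

end IsCompatible

/-- `K` is the join of the boundary complexes of the simplices spanned by the fibres of `β`: its
faces are the nonempty sets of vertices that contain no fibre. -/
def IsBoundaryJoin (K : AbstractSimplicialComplex V) (β : V → ι) : Prop :=
  ∀ F : Finset V, F ∈ K.faces ↔ F.Nonempty ∧ ∀ v, ∃ u ∉ F, β u = β v

theorem IsCompatible.isBoundaryJoin {U T : Finset V} {β : V → ι} (h : IsCompatible K n U β T)
    (hK : IsType34 K n) : IsBoundaryJoin K β := by
  intro F
  constructor
  · intro hF
    refine ⟨(K.isRelLowerSet_faces hF).1, fun v => ?_⟩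
    obtain ⟨A, hA, hFA⟩ := hK.pure.exists_top F hF
    by_cases hv : v ∈ A
    · obtain ⟨w, hw, hwv, -⟩ := (h.of_isTopFace hK hA).exchange v hv
      exact ⟨w, fun hwF => (Finset.mem_sdiff.1 hw).2 (hFA hwF), hwv⟩
    · exact ⟨v, fun hvF => hv (hFA hvF), rfl⟩
  · rintro ⟨hne, hF⟩
    obtain ⟨A, hA, hFA⟩ := h.exists_superset hK hF
    exact mem_faces_of_subset hA.facet.1 hne hFA

omit [DecidableEq V] in
theorem IsType34.exists_isBoundaryJoin (hK : IsType34 K n) :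
    ∃ (t : ℕ) (β : V → Fin t), Function.Surjective β ∧ IsBoundaryJoin K β ∧
      Nat.card V = n + 1 + t := by
  classical
  obtain ⟨S, hS⟩ := hK.pure.nonempty
  obtain ⟨T, hT, -⟩ := hK.pure.exists_top S hS
  obtain ⟨U, β, h⟩ := hK.closed.exists_isCompatible hT
  have : Fintype V := ⟨U, h.mem hK⟩
  have hU : U = Finset.univ := Finset.eq_univ_iff_forall.2 (h.mem hK)
  have himage : (U \ T).image β = U.image β := by
    refine (Finset.image_subset_image Finset.sdiff_subset).antisymm fun b hb => ?_
    obtain ⟨v, hv, rfl⟩ := Finset.mem_image.1 hb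
    by_cases hvT : v ∈ T
    · obtain ⟨w, hw, hwv, -⟩ := h.exchange v hvT
      exact Finset.mem_image.2 ⟨w, hw, hwv⟩
    · exact Finset.mem_image_of_mem β (Finset.mem_sdiff.2 ⟨hv, hvT⟩)
  have hcard : U.card = n + 1 + (U.image β).card := by
    rw [← himage, Finset.card_image_of_injOn h.injOn, ← hT.2, add_comm,
      Finset.card_sdiff_add_card_eq_card h.subset]
  refine ⟨_, fun v => (U.image β).equivFin ⟨β v, Finset.mem_image_of_mem β (h.mem hK v)⟩,
    fun i => ?_, fun F => ?_, ?_⟩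
  · obtain ⟨v, -, hv⟩ := Finset.mem_image.1 ((U.image β).equivFin.symm i).2
    exact ⟨v, by simp [hv]⟩
  · simpa using h.isBoundaryJoin hK F
  · rw [Nat.card_eq_fintype_card, ← Finset.card_univ, ← hU, hcard]

end Combinatorics

namespace IsBoundaryJoin

variable {V ι : Type*} {K : AbstractSimplicialComplex V} {β : V → ι}

theorem exists_ne (h : IsBoundaryJoin K β) (v : V) : ∃ u ≠ v, β u = β v := by
  obtain ⟨u, hu, huv⟩ := ((h {v}).1 (K.singleton_mem v)).2 v
  exact ⟨u, fun h => hu (Finset.mem_singleton.2 h), huv⟩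

-- The fibres are the minimal non-faces.
theorem apply_eq_apply_iff [Finite V] (h : IsBoundaryJoin K β) {u v : V} :
    β u = β v ↔ ∃ N ∉ K.faces, u ∈ N ∧ v ∈ N ∧ ∀ F ⊂ N, F.Nonempty → F ∈ K.faces := by
  classical
  constructor
  · intro huv
    have := Fintype.ofFinite V
    refine ⟨({x | β x = β v} : Finset V), fun hN => ?_, by simpa using huv, by simp,
      fun F hF hne => (h F).2 ⟨hne, fun x => ?_⟩⟩
    · obtain ⟨x, hx, hxv⟩ := ((h _).1 hN).2 v
      exact hx (by simpa using hxv)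
    · by_cases hx : β x = β v
      · obtain ⟨y, hy, hyF⟩ := Finset.exists_of_ssubset hF
        exact ⟨y, hyF, by simp_all⟩
      · exact ⟨x, fun hxF => hx (by simpa using hF.1 hxF), rfl⟩
  · rintro ⟨N, hN, hu, hv, hmin⟩
    obtain ⟨x, hx⟩ : ∃ x, ∀ y, β y = β x → y ∈ N := by
      by_contra! hcon
      exact hN ((h N).2 ⟨⟨u, hu⟩, fun x => by simpa [and_comm] using hcon x⟩)
    have key : ∀ y ∈ N, ∀ z ∈ N, z ≠ y → β y = β x := by
      intro y hy z hz hzy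
      obtain ⟨w, hw, hwx⟩ := ((h _).1 (hmin _ (Finset.erase_ssubset hy)
        ⟨z, Finset.mem_erase.2 ⟨hzy, hz⟩⟩)).2 x
      grind
    obtain rfl | huv := eq_or_ne u v
    · rfl
    · rw [key u hu v hv huv.symm, key v hv u hu huv]

theorem apply_perm_eq [Finite V] (h : IsBoundaryJoin K β) {σ : Equiv.Perm V} (hσ : σ ∈ autGroup K)
    {u v : V} (huv : β u = β v) : β (σ u) = β (σ v) := by
  obtain ⟨N, hN, hu, hv, hmin⟩ := h.apply_eq_apply_iff.1 huv
  refine h.apply_eq_apply_iff.2 ⟨N.map σ.toEmbedding, fun hN' => hN ((hσ N).1 hN'),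
    Finset.mem_map_of_mem _ hu, Finset.mem_map_of_mem _ hv, fun F hF hne => ?_⟩
  obtain ⟨G, _, rfl⟩ := Finset.subset_map_iff.1 hF.subset
  exact (hσ G).2 (hmin G (Finset.map_ssubset_map.1 hF) (Finset.map_nonempty.1 hne))

theorem apply_perm_eq_iff [Finite V] (h : IsBoundaryJoin K β) {σ : Equiv.Perm V}
    (hσ : σ ∈ autGroup K) {u v : V} : β (σ u) = β (σ v) ↔ β u = β v :=
  ⟨fun huv => by simpa using h.apply_perm_eq (inv_mem hσ) huv, h.apply_perm_eq hσ⟩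

end IsBoundaryJoin

section BlockFrame

open scoped RealInnerProductSpace

/-- The coordinate map `x ↦ (⟪φ v, x⟫)ᵥ` is an isometry of `E` onto the space of functions
`V → ℝ` whose sum over every fibre of `β` vanishes, so that `φ v` corresponds to the orthogonal
projection of the `v`-th basis vector of `ℝ^V`. That the map is isometric is expressed by
`sum_inner_smul`, which says that its adjoint is a left inverse. -/
structure IsBlockFrame {V ι E : Type*} [Fintype V] [DecidableEq ι]
    [NormedAddCommGroup E] [InnerProductSpace ℝ E] (β : V → ι) (φ : V → E) : Prop where
  sum_fiber : ∀ v, ∑ w with β w = β v, φ w = 0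
  exists_inner_eq : ∀ y : V → ℝ, (∀ v, ∑ w with β w = β v, y w = 0) → ∃ x, ∀ v, ⟪φ v, x⟫ = y v
  sum_inner_smul : ∀ x, ∑ v, ⟪φ v, x⟫ • φ v = x

namespace IsBlockFrame

variable {V W ι κ E E' : Type*} [Fintype V] [Fintype W] [DecidableEq ι] [DecidableEq κ]
  [NormedAddCommGroup E] [InnerProductSpace ℝ E] [NormedAddCommGroup E'] [InnerProductSpace ℝ E']
  {β : V → ι} {φ : V → E} {φ' : V → E'}

theorem ext_inner (h : IsBlockFrame β φ) {x y : E} (hxy : ∀ v, ⟪φ v, x⟫ = ⟪φ v, y⟫) : x = y := by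
  rw [← h.sum_inner_smul x, ← h.sum_inner_smul y]
  simp_rw [hxy]

theorem sum_eq_zero (h : IsBlockFrame β φ) : ∑ v, φ v = 0 := by
  rw [← Finset.sum_fiberwise_of_maps_to (fun v _ => Finset.mem_image_of_mem β (Finset.mem_univ v))]
  refine Finset.sum_eq_zero fun i hi => ?_
  obtain ⟨v, -, rfl⟩ := Finset.mem_image.1 hi
  exact h.sum_fiber v

theorem sum_inner_eq_zero (h : IsBlockFrame β φ) (x : E) : ∑ v, ⟪φ v, x⟫ = 0 := by
  rw [← sum_inner, h.sum_eq_zero, inner_zero_left]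

theorem mem_convexHull [Nonempty V] (h : IsBlockFrame β φ) {x : E}
    (hx : ∀ v, -(Fintype.card V : ℝ)⁻¹ ≤ ⟪φ v, x⟫) : x ∈ convexHull ℝ (Set.range φ) := by
  refine mem_convexHull_of_exists_fintype (fun v => ⟪φ v, x⟫ + (Fintype.card V : ℝ)⁻¹) φ
    (fun v => by linarith [hx v]) ?_ (fun v => Set.mem_range_self v) ?_
  · simp [Finset.sum_add_distrib, h.sum_inner_eq_zero]
  · simp_rw [add_smul]
    rw [Finset.sum_add_distrib, h.sum_inner_smul, ← Finset.smul_sum, h.sum_eq_zero, smul_zero,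
      add_zero]

theorem zero_mem_interior [Nonempty V] (h : IsBlockFrame β φ) :
    (0 : E) ∈ interior (convexHull ℝ (Set.range φ)) := by
  have hopen : IsOpen {x : E | ∀ v, -(Fintype.card V : ℝ)⁻¹ < ⟪φ v, x⟫} := by
    simp only [Set.ofPred_forall]
    exact isOpen_iInter_of_finite fun v => isOpen_lt continuous_const (by fun_prop)
  refine mem_interior.2 ⟨_, fun x hx => h.mem_convexHull fun v => (hx v).le, hopen, fun v => ?_⟩
  rw [inner_zero_right, neg_lt_zero]
  positivity

theorem inner_sub [DecidableEq V] (h : IsBlockFrame β φ) {u v : V} (huv : β u = β v) (w : V) :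
    ⟪φ w, φ u - φ v⟫ = (if w = u then 1 else 0) - if w = v then 1 else 0 := by
  obtain ⟨x, hx⟩ := h.exists_inner_eq (fun w => (if w = u then 1 else 0) - if w = v then 1 else 0)
    fun i => by simp [Finset.sum_sub_distrib, huv]
  have hxuv : x = φ u - φ v := by
    rw [← h.sum_inner_smul x]
    simp [hx, sub_smul, Finset.sum_sub_distrib]
  rw [← hxuv, hx]

theorem eq_of_sum_smul_eq_zero (h : IsBlockFrame β φ) {c : V → ℝ} (hc : ∑ w, c w • φ w = 0)
    {u v : V} (huv : β u = β v) : c u = c v := by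
  classical
  have hpair : ⟪∑ w, c w • φ w, φ u - φ v⟫ = c u - c v := by
    simp [sum_inner, real_inner_smul_left, h.inner_sub huv, mul_sub]
  rw [hc, inner_zero_left] at hpair
  linarith

theorem linearIndependent (h : IsBlockFrame β φ) {F : Finset V} (hF : ∀ v, ∃ u ∉ F, β u = β v) :
    LinearIndependent ℝ (fun v : F => φ v) := by
  classical
  rw [Fintype.linearIndependent_iff]
  intro c hc v
  let c' : V → ℝ := fun u => if hu : u ∈ F then c ⟨u, hu⟩ else 0
  have hc' : ∑ u, c' u • φ u = 0 := by
    rw [← hc, ← Finset.sum_subset (Finset.subset_univ F) (fun u _ hu => by simp [c', hu]),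
      ← Finset.sum_coe_sort F]
    exact Finset.sum_congr rfl fun u _ => by simp [c']
  obtain ⟨u, huF, huv⟩ := hF v
  simpa [c', huF] using (h.eq_of_sum_smul_eq_zero hc' huv).symm

theorem injective (h : IsBlockFrame β φ) (hβ : ∀ v, ∃ u ≠ v, β u = β v) :
    Function.Injective φ := by
  classical
  intro u v huv
  by_contra hne
  obtain ⟨w, hwu, hw⟩ := hβ u
  have huw := h.inner_sub hw u
  have hvw := h.inner_sub hw v
  rw [← huv] at hvw
  grind

theorem comp_equiv (h : IsBlockFrame β φ) (f : W ≃ V) {γ : W → κ}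
    (hγ : ∀ u v, γ u = γ v ↔ β (f u) = β (f v)) : IsBlockFrame γ (φ ∘ f) := by
  refine ⟨fun v => ?_, fun y hy => ?_, fun x => ?_⟩
  · rw [← h.sum_fiber (f v)]
    exact Finset.sum_equiv f (by simp [hγ]) fun _ _ => rfl
  · obtain ⟨x, hx⟩ := h.exists_inner_eq (y ∘ f.symm) fun v => by
      rw [← hy (f.symm v)]
      exact Finset.sum_equiv f.symm (by simp [hγ]) fun _ _ => rfl
    exact ⟨x, fun v => by simp [hx]⟩
  · exact (f.sum_comp fun v => ⟪φ v, x⟫ • φ v).trans (h.sum_inner_smul x)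

theorem map (h : IsBlockFrame β φ) (e : E ≃ₗᵢ[ℝ] E') : IsBlockFrame β (e ∘ φ) := by
  refine ⟨fun i => ?_, fun y hy => ?_, fun x => ?_⟩
  · simp only [Function.comp_apply, ← map_sum, h.sum_fiber, map_zero]
  · obtain ⟨x, hx⟩ := h.exists_inner_eq y hy
    exact ⟨e x, fun v => by rw [Function.comp_apply, e.inner_map_map, hx]⟩
  · obtain ⟨x, rfl⟩ := e.surjective x
    simp only [Function.comp_apply, e.inner_map_map, ← map_smul, ← map_sum, h.sum_inner_smul]

theorem inner_sum_inner_smul (h : IsBlockFrame β φ) (h' : IsBlockFrame β φ') (x : E) (v : V) :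
    ⟪φ' v, ∑ u, ⟪φ u, x⟫ • φ' u⟫ = ⟪φ v, x⟫ := by
  obtain ⟨x', hx'⟩ := h'.exists_inner_eq (fun v => ⟪φ v, x⟫) fun v => by
    rw [← sum_inner, h.sum_fiber, inner_zero_left]
  simp only [← hx', h'.sum_inner_smul]

theorem exists_linearIsometryEquiv (h : IsBlockFrame β φ) (h' : IsBlockFrame β φ') :
    ∃ e : E ≃ₗᵢ[ℝ] E', ∀ v, e (φ v) = φ' v := by
  let f : E →ₗ[ℝ] E' := ∑ v, (innerₛₗ ℝ (φ v)).smulRight (φ' v)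
  let g : E' →ₗ[ℝ] E := ∑ v, (innerₛₗ ℝ (φ' v)).smulRight (φ v)
  have hf : ∀ x v, ⟪φ' v, f x⟫ = ⟪φ v, x⟫ := fun x v => by
    simpa [f] using h.inner_sum_inner_smul h' x v
  have hg : ∀ x v, ⟪φ v, g x⟫ = ⟪φ' v, x⟫ := fun x v => by
    simpa [g] using h'.inner_sum_inner_smul h x v
  have hfg : f ∘ₗ g = .id := LinearMap.ext fun x => h'.ext_inner fun v => by simp [hf, hg]
  have hgf : g ∘ₗ f = .id := LinearMap.ext fun x => h.ext_inner fun v => by simp [hf, hg]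
  have inner_map : ∀ x y, ⟪f x, f y⟫ = ⟪x, y⟫ := fun x y => calc
    ⟪f x, f y⟫ = ∑ v, ⟪φ v, x⟫ * ⟪φ' v, f y⟫ := by simp [f, sum_inner, real_inner_smul_left]
    _ = ⟪∑ v, ⟪φ v, x⟫ • φ v, y⟫ := by simp [hf, sum_inner, real_inner_smul_left]
    _ = ⟪x, y⟫ := by rw [h.sum_inner_smul]
  refine ⟨(LinearEquiv.ofLinearMap f g hfg hgf).isometryOfInner inner_map, fun v => ?_⟩
  refine ext_inner_right ℝ fun y => ?_
  obtain ⟨x, rfl⟩ : ∃ x, f x = y := ⟨g y, LinearMap.congr_fun hfg y⟩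
  exact (inner_map (φ v) x).trans (hf x v).symm

end IsBlockFrame

end BlockFrame

section Faces

open scoped RealInnerProductSpace

section Exposed

variable {V E : Type*} [NormedAddCommGroup E] [NormedSpace ℝ E]

theorem toExposed_convexHull_range_subset (φ : V → E) (l : StrongDual ℝ E) :
    l.toExposed (convexHull ℝ (Set.range φ)) ⊆
      convexHull ℝ (φ '' {v | ∀ u, l (φ u) ≤ l (φ v)}) := by
  classical
  rintro x ⟨hx, hmax⟩
  obtain ⟨κ, _, w, z, hw0, hw1, hz, rfl⟩ := mem_convexHull_iff_exists_fintype.1 hx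
  set x := ∑ i, w i • z i with hxdef
  have hgap : ∀ i, 0 ≤ w i * (l x - l (z i)) := fun i =>
    mul_nonneg (hw0 i) (sub_nonneg.2 (hmax _ (subset_convexHull ℝ _ (hz i))))
  have hgap_sum : ∑ i, w i * (l x - l (z i)) = 0 := by
    simp_rw [mul_sub]
    rw [Finset.sum_sub_distrib, ← Finset.sum_mul, hw1, hxdef, map_sum]
    simp
  have apply_eq : ∀ i, w i ≠ 0 → l (z i) = l x := fun i hi => by
    have h := (Finset.sum_eq_zero_iff_of_nonneg fun i _ => hgap i).1 hgap_sum i (Finset.mem_univ i)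
    linarith [(mul_eq_zero.1 h).resolve_left hi]
  have hxsupp : x = ∑ i with w i ≠ 0, w i • z i := by
    refine (Finset.sum_filter_of_ne fun i _ hi => ?_).symm
    exact left_ne_zero_of_smul hi
  rw [hxsupp]
  refine (convex_convexHull ℝ _).sum_mem (fun i _ => hw0 i) (by rwa [Finset.sum_filter_ne_zero])
    fun i hi => subset_convexHull ℝ _ ?_
  obtain ⟨v, hv⟩ := hz i
  refine ⟨v, fun u => ?_, hv⟩
  rw [hv, apply_eq i (Finset.mem_filter.1 hi).2]
  exact hmax _ (subset_convexHull ℝ _ (Set.mem_range_self u))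

theorem toExposed_convexHull_range (φ : V → E) (l : StrongDual ℝ E) :
    l.toExposed (convexHull ℝ (Set.range φ)) =
      convexHull ℝ (φ '' {v | ∀ u, l (φ u) ≤ l (φ v)}) := by
  refine (toExposed_convexHull_range_subset φ l).antisymm ?_
  refine convexHull_min ?_
    (ContinuousLinearMap.toExposed.isExposed.convex (convex_convexHull ℝ _))
  rintro _ ⟨v, hv, rfl⟩
  refine ⟨subset_convexHull ℝ _ (Set.mem_range_self v), ?_⟩
  exact convexHull_min (Set.forall_mem_range.2 hv) (convex_halfSpace_le l.toLinearMap.isLinear _)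

end Exposed

namespace IsBlockFrame

variable {V ι E : Type*} [Fintype V] [DecidableEq ι] [NormedAddCommGroup E]
  [InnerProductSpace ℝ E] {β : V → ι} {φ : V → E}

theorem apply_eq_zero_of_isMax_fiber (h : IsBlockFrame β φ) {l : StrongDual ℝ E} {v : V}
    (hl : ∀ u, β u = β v → ∀ w, l (φ w) ≤ l (φ u)) (w : V) : l (φ w) = 0 := by
  have hsum : ∀ u, ∑ w with β w = β u, l (φ w) = 0 := fun u => by
    rw [← map_sum, h.sum_fiber, map_zero]
  have hv : l (φ v) = 0 := by
    have hconst : ∀ w ∈ ({w | β w = β v} : Finset V), l (φ w) = l (φ v) := fun w hw =>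
      (hl v rfl w).antisymm (hl w (Finset.mem_filter.1 hw).2 v)
    have hsmul := hsum v
    rw [Finset.sum_eq_card_nsmul hconst, smul_eq_zero] at hsmul
    exact hsmul.resolve_left (Finset.card_ne_zero_of_mem (a := v) (by simp))
  have hnonpos : ∀ u, l (φ u) ≤ 0 := fun u => hv ▸ hl v rfl u
  exact (Finset.sum_eq_zero_iff_of_nonpos fun u _ => hnonpos u).1 (hsum w) w (by simp)

theorem exists_apply_eq_one_and_nonpos (h : IsBlockFrame β φ) {F : Finset V}
    (hF : ∀ v, ∃ u ∉ F, β u = β v) :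
    ∃ l : StrongDual ℝ E, (∀ v ∈ F, l (φ v) = 1) ∧ ∀ v ∉ F, l (φ v) ≤ 0 := by
  classical
  choose τ hτF hτ using hF
  have hl : ∀ w, innerSL ℝ (∑ v ∈ F, (φ v - φ (τ v))) (φ w) =
      (if w ∈ F then 1 else 0) - ∑ v ∈ F, if w = τ v then 1 else 0 := fun w => by
    simp_rw [innerSL_apply_apply, real_inner_comm, inner_sum, h.inner_sub (hτ _).symm]
    rw [Finset.sum_sub_distrib, Finset.sum_ite_eq]
  refine ⟨innerSL ℝ (∑ v ∈ F, (φ v - φ (τ v))), fun w hw => ?_, fun w hw => ?_⟩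
  · rw [hl, if_pos hw, Finset.sum_eq_zero, sub_zero]
    exact fun v _ => if_neg (ne_of_mem_of_not_mem hw (hτF v))
  · rw [hl, if_neg hw, zero_sub, neg_nonpos]
    positivity

variable {K : AbstractSimplicialComplex V}

theorem exists_face_of_isExposed (h : IsBlockFrame β φ) (hK : IsBoundaryJoin K β) {B : Set E}
    (hne : B.Nonempty) (hproper : B ≠ convexHull ℝ (Set.range φ))
    (hB : IsExposed ℝ (convexHull ℝ (Set.range φ)) B) :
    ∃ F ∈ K.faces, B = convexHull ℝ (φ '' (F : Set V)) := by
  classical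
  obtain ⟨l, hl⟩ := hB hne
  replace hl : B = convexHull ℝ (φ '' {v | ∀ u, l (φ u) ≤ l (φ v)}) :=
    hl.trans (toExposed_convexHull_range φ l)
  refine ⟨({v | ∀ u, l (φ u) ≤ l (φ v)} : Finset V), (hK _).2 ⟨?_, fun v => ?_⟩, by simpa using hl⟩
  · rw [hl, convexHull_nonempty_iff, Set.image_nonempty] at hne
    obtain ⟨v, hv⟩ := hne
    exact ⟨v, by simpa using hv⟩
  · by_contra! hfiber
    have hzero := h.apply_eq_zero_of_isMax_fiber (l := l) (v := v) fun u hu => by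
      by_contra hmax
      exact hfiber u (by simpa using hmax) hu
    exact hproper (by simpa [hzero] using hl)

theorem isExposed_of_mem_faces (h : IsBlockFrame β φ) (hK : IsBoundaryJoin K β) {F : Finset V}
    (hF : F ∈ K.faces) :
    convexHull ℝ (φ '' F) ≠ convexHull ℝ (Set.range φ) ∧
      IsExposed ℝ (convexHull ℝ (Set.range φ)) (convexHull ℝ (φ '' F)) := by
  obtain ⟨⟨v, hv⟩, hFβ⟩ := (hK F).1 hF
  obtain ⟨l, hl_one, hl_nonpos⟩ := h.exists_apply_eq_one_and_nonpos hFβ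
  have hFmax : (F : Set V) = {v | ∀ u, l (φ u) ≤ l (φ v)} := by
    ext w
    refine ⟨fun hw u => ?_, fun hw => ?_⟩
    · rw [hl_one w hw]
      by_cases hu : u ∈ F
      · exact (hl_one u hu).le
      · linarith [hl_nonpos u hu]
    · by_contra hwF
      linarith [hl_nonpos w hwF, hw v, hl_one v hv]
  rw [hFmax, ← toExposed_convexHull_range]
  refine ⟨fun heq => ?_, ContinuousLinearMap.toExposed.isExposed⟩
  obtain ⟨u, hu, -⟩ := hFβ v
  have humax := (heq.superset (subset_convexHull ℝ _ (Set.mem_range_self u))).2 (φ v)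
    (subset_convexHull ℝ _ (Set.mem_range_self v))
  linarith [hl_nonpos u hu, hl_one v hv]

theorem isPolytopalRealization [Nonempty V] (h : IsBlockFrame β φ) (hK : IsBoundaryJoin K β) :
    IsPolytopalRealization K φ where
  finite := inferInstance
  injective := h.injective hK.exists_ne
  full_dim := ⟨0, h.zero_mem_interior⟩
  vertices := by
    refine extremePoints_convexHull_subset.antisymm ?_
    rintro _ ⟨v, rfl⟩
    have hexp := (h.isExposed_of_mem_faces hK (K.singleton_mem v)).2
    rw [Finset.coe_singleton, Set.image_singleton, convexHull_singleton] at hexp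
    exact isExtreme_singleton.1 hexp.isExtreme
  simplices F hF := (h.linearIndependent ((hK F).1 hF).2).affineIndependent
  faces B := by
    refine ⟨fun ⟨hne, hproper, hB⟩ => h.exists_face_of_isExposed hK hne hproper hB, ?_⟩
    rintro ⟨F, hF, rfl⟩
    exact ⟨((K.isRelLowerSet_faces hF).1.to_set.image φ).convexHull, h.isExposed_of_mem_faces hK hF⟩

end IsBlockFrame

end Faces

section Symmetry

theorem isExposed_image {E F : Type*} [NormedAddCommGroup E] [NormedSpace ℝ E]
    [NormedAddCommGroup F] [NormedSpace ℝ F] {P B : Set E} (h : IsExposed ℝ P B)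
    (g : E ≃ᵃⁱ[ℝ] F) : IsExposed ℝ (g '' P) (g '' B) := by
  intro hB
  obtain ⟨l, rfl⟩ := h (Set.image_nonempty.1 hB)
  let l' : StrongDual ℝ F := l ∘L (g.symm.linearIsometryEquiv.toContinuousLinearEquiv : F →L[ℝ] E)
  have apply_le_iff : ∀ x y, l' (g y) ≤ l' (g x) ↔ l y ≤ l x := by
    intro x y
    have hsymm : g.symm.linearIsometryEquiv (g y - g x) = y - x := by
      simpa using g.symm.map_vsub (g y) (g x)
    have hl' : l' (g y - g x) = l (y - x) := congrArg l hsymm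
    rw [← sub_nonpos, ← map_sub, hl', map_sub, sub_nonpos]
  refine ⟨l', ?_⟩
  ext z
  obtain ⟨x, rfl⟩ := g.surjective z
  simp [apply_le_iff]

namespace IsPolytopalRealization

variable {V E : Type*} [NormedAddCommGroup E] [InnerProductSpace ℝ E]
  {K : AbstractSimplicialComplex V} {φ : V → E}

theorem apply_mem_convexHull_image_iff (h : IsPolytopalRealization K φ) {s : Set V} {v : V} :
    φ v ∈ convexHull ℝ (φ '' s) ↔ v ∈ s := by
  refine ⟨fun hv => ?_, fun hv => subset_convexHull ℝ _ (Set.mem_image_of_mem φ hv)⟩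
  have hext : φ v ∈ (convexHull ℝ (φ '' s)).extremePoints ℝ :=
    inter_extremePoints_subset_extremePoints_of_subset
      (convexHull_mono (Set.image_subset_range φ s))
      ⟨hv, h.vertices.superset (Set.mem_range_self v)⟩
  exact (h.injective.mem_set_image).1 (extremePoints_convexHull_subset hext)

theorem exists_image_eq (h : IsPolytopalRealization K φ) {g : E ≃ᵢ E}
    (hg : g ∈ isometryGroupOf (convexHull ℝ (Set.range φ))) {F : Finset V} (hF : F ∈ K.faces) :
    ∃ G ∈ K.faces, g '' convexHull ℝ (φ '' F) = convexHull ℝ (φ '' (G : Set V)) := by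
  obtain ⟨hne, hproper, hexp⟩ := (h.faces _).2 ⟨F, hF, rfl⟩
  have hg : g '' convexHull ℝ (Set.range φ) = convexHull ℝ (Set.range φ) := hg
  refine (h.faces _).1 ⟨hne.image g, fun heq => hproper ?_, ?_⟩
  · exact g.injective.image_injective (heq.trans hg.symm)
  · have := isExposed_image hexp g.toRealAffineIsometryEquiv
    rwa [IsometryEquiv.coeFn_toRealAffineIsometryEquiv, hg] at this

theorem exists_apply_eq (h : IsPolytopalRealization K φ) {g : E ≃ᵢ E}
    (hg : g ∈ isometryGroupOf (convexHull ℝ (Set.range φ))) (v : V) : ∃ w, φ w = g (φ v) := by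
  obtain ⟨G, hG, himage⟩ := h.exists_image_eq hg (K.singleton_mem v)
  rw [Finset.coe_singleton, Set.image_singleton, convexHull_singleton,
    Set.image_singleton] at himage
  obtain ⟨w, hw⟩ := (K.isRelLowerSet_faces hG).1
  exact ⟨w, himage.superset (subset_convexHull ℝ _ ⟨w, hw, rfl⟩)⟩

theorem image_convexHull_image {g : E ≃ᵢ E} {σ : Equiv.Perm V} (hσ : ∀ v, g (φ v) = φ (σ v))
    (s : Set V) : g '' convexHull ℝ (φ '' s) = convexHull ℝ (φ '' (σ '' s)) := by
  have := g.toRealAffineIsometryEquiv.toAffineMap.image_convexHull (φ '' s)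
  simpa [Set.image_image, hσ] using this

theorem map_mem_faces (h : IsPolytopalRealization K φ) {g : E ≃ᵢ E}
    (hg : g ∈ isometryGroupOf (convexHull ℝ (Set.range φ))) {σ : Equiv.Perm V}
    (hσ : ∀ v, g (φ v) = φ (σ v)) {F : Finset V} (hF : F ∈ K.faces) :
    F.map σ.toEmbedding ∈ K.faces := by
  obtain ⟨G, hG, himage⟩ := h.exists_image_eq hg hF
  rw [image_convexHull_image hσ] at himage
  convert hG
  ext v
  rw [← Finset.mem_coe (s := G), ← h.apply_mem_convexHull_image_iff, ← himage,
    h.apply_mem_convexHull_image_iff, ← Finset.mem_coe, Finset.coe_map, Equiv.coe_toEmbedding]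

theorem exists_perm (h : IsPolytopalRealization K φ) {g : E ≃ᵢ E}
    (hg : g ∈ isometryGroupOf (convexHull ℝ (Set.range φ))) :
    ∃ σ ∈ autGroup K, ∀ v, g (φ v) = φ (σ v) := by
  have := h.finite
  choose f hf using h.exists_apply_eq hg
  have hinj : Function.Injective f := fun u v huv =>
    h.injective (g.injective (by rw [← hf, ← hf, huv]))
  let σ : Equiv.Perm V := Equiv.ofBijective f (Finite.injective_iff_bijective.1 hinj)
  have hσ : ∀ v, g (φ v) = φ (σ v) := fun v => (hf v).symm
  have hσ' : ∀ v, g⁻¹ (φ v) = φ (σ⁻¹ v) := fun v => by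
    rw [← σ.apply_symm_apply v, ← hσ]
    simp
  refine ⟨σ, fun F => ⟨fun hF => ?_, h.map_mem_faces hg hσ⟩, hσ⟩
  have hF' := h.map_mem_faces (inv_mem hg) hσ' hF
  rw [Finset.map_map] at hF'
  convert hF'
  ext v
  simp

theorem mem_isometryGroupOf {g : E ≃ᵢ E} {σ : Equiv.Perm V} (hσ : ∀ v, g (φ v) = φ (σ v)) :
    g ∈ isometryGroupOf (convexHull ℝ (Set.range φ)) := by
  change g '' convexHull ℝ (Set.range φ) = convexHull ℝ (Set.range φ)
  rw [← Set.image_univ, image_convexHull_image hσ, Set.image_univ_of_surjective σ.surjective]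

theorem isometry_ext (h : IsPolytopalRealization K φ) {g g' : E ≃ᵢ E}
    (heq : ∀ v, g (φ v) = g' (φ v)) : g = g' := by
  have hspan := affineSpan_eq_top_of_nonempty_interior h.full_dim
  have := AffineMap.ext_on hspan (f := g.toRealAffineIsometryEquiv.toAffineMap)
    (g := g'.toRealAffineIsometryEquiv.toAffineMap) (Set.forall_mem_range.2 heq)
  exact IsometryEquiv.ext fun x => DFunLike.congr_fun this x

theorem exists_mulEquiv (h : IsPolytopalRealization K φ)
    (hsymm : ∀ σ ∈ autGroup K, ∃ g : E ≃ᵢ E, ∀ v, g (φ v) = φ (σ v)) :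
    ∃ Φ : isometryGroupOf (convexHull ℝ (Set.range φ)) ≃* autGroup K,
      ∀ (g : isometryGroupOf (convexHull ℝ (Set.range φ))) (v : V),
        (g : E ≃ᵢ E) (φ v) = φ ((Φ g : Equiv.Perm V) v) := by
  choose s hs hsφ using fun g : isometryGroupOf (convexHull ℝ (Set.range φ)) => h.exists_perm g.2
  let Φ : isometryGroupOf (convexHull ℝ (Set.range φ)) →* autGroup K :=
    MonoidHom.mk' (fun g => ⟨s g, hs g⟩) fun g g' => by
      refine Subtype.ext (Equiv.ext fun v => h.injective ?_)
      change φ (s (g * g') v) = φ (s g (s g' v))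
      rw [← hsφ, ← hsφ, ← hsφ]
      rfl
  have hΦ : ∀ (g : isometryGroupOf (convexHull ℝ (Set.range φ))) (v : V),
      (g : E ≃ᵢ E) (φ v) = φ ((Φ g : Equiv.Perm V) v) := hsφ
  refine ⟨MulEquiv.ofBijective Φ ⟨fun g g' hgg' => ?_, fun σ => ?_⟩, hΦ⟩
  · exact Subtype.ext (h.isometry_ext fun v => by rw [hΦ, hΦ, hgg'])
  · obtain ⟨g, hg⟩ := hsymm σ σ.2
    refine ⟨⟨g, mem_isometryGroupOf hg⟩, Subtype.ext (Equiv.ext fun v => h.injective ?_)⟩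
    rw [← hΦ]
    exact hg v

end IsPolytopalRealization

theorem IsBlockFrame.exists_isometryEquiv {V ι E : Type*} [Fintype V] [DecidableEq ι]
    [NormedAddCommGroup E] [InnerProductSpace ℝ E] {K : AbstractSimplicialComplex V}
    {β : V → ι} {φ : V → E} (h : IsBlockFrame β φ) (hK : IsBoundaryJoin K β) {σ : Equiv.Perm V}
    (hσ : σ ∈ autGroup K) : ∃ g : E ≃ᵢ E, ∀ v, g (φ v) = φ (σ v) := by
  obtain ⟨e, he⟩ := h.exists_linearIsometryEquiv
    (h.comp_equiv σ fun _ _ => (hK.apply_perm_eq_iff hσ).symm)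
  exact ⟨e.toIsometryEquiv, he⟩

end Symmetry

section Existence

open scoped RealInnerProductSpace Pointwise

section PolarDual

variable {E E' : Type*} [NormedAddCommGroup E] [InnerProductSpace ℝ E] [NormedAddCommGroup E']
  [InnerProductSpace ℝ E']

theorem polarDual_convexHull (s : Set E) : polarDual (convexHull ℝ s) = polarDual s := by
  refine Set.Subset.antisymm (fun y hy x hx => hy x (subset_convexHull ℝ s hx)) fun y hy => ?_
  refine convexHull_min hy ?_
  simp_rw [real_inner_comm]
  exact convex_halfSpace_le (innerₛₗ ℝ y).isLinear 1

theorem mem_polarDual_range {V : Type*} {φ : V → E} {y : E} :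
    y ∈ polarDual (Set.range φ) ↔ ∀ v, ⟪φ v, y⟫ ≤ 1 :=
  Set.forall_mem_range

theorem image_polarDual (e : E ≃ₗᵢ[ℝ] E') (s : Set E) :
    e '' polarDual s = polarDual (e '' s) := by
  ext y
  obtain ⟨x, rfl⟩ := e.surjective y
  simp [polarDual]

end PolarDual

theorem isBlockFrame_orthogonalProjectionOnto {V ι : Type*} [Fintype V] [DecidableEq V]
    [DecidableEq ι] {β : V → ι} {p : Submodule ℝ (EuclideanSpace ℝ V)}
    (hp : ∀ x, x ∈ p ↔ ∀ v, ∑ w with β w = β v, x w = 0) :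
    IsBlockFrame β fun v => p.orthogonalProjectionOnto (EuclideanSpace.single v 1) := by
  have hinner : ∀ v (x : p),
      ⟪p.orthogonalProjectionOnto (EuclideanSpace.single v 1), x⟫ = (x : EuclideanSpace ℝ V) v :=
    fun v x => by simp [EuclideanSpace.inner_single_left]
  refine ⟨fun v => ext_inner_right ℝ fun x => ?_, fun y hy => ?_, fun x => ?_⟩
  · rw [sum_inner, inner_zero_left, ← (hp x).1 x.2 v]
    exact Finset.sum_congr rfl fun w _ => hinner w x
  · exact ⟨⟨WithLp.toLp 2 y, (hp _).2 hy⟩, fun v => hinner v _⟩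
  · simp_rw [hinner, ← map_smul, ← map_sum]
    rw [← p.orthogonalProjectionOnto_mem_subspace_eq_self x]
    congr 1
    ext v
    simp [Pi.single_apply]

theorem exists_isBlockFrame_unit (m : ℕ) :
    ∃ ψ : Fin (m + 1) → EuclideanSpace ℝ (Fin m), IsBlockFrame (fun _ => ()) ψ := by
  let one : EuclideanSpace ℝ (Fin (m + 1)) := WithLp.toLp 2 fun _ => 1
  have hone : one ≠ 0 := fun h => one_ne_zero (congrArg (fun x : EuclideanSpace ℝ _ => x 0) h)
  have hp : ∀ x, x ∈ (ℝ ∙ one)ᗮ ↔ ∀ _ : Fin (m + 1), ∑ w with () = (), x w = 0 := fun x => by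
    rw [Submodule.mem_orthogonal_singleton_iff_inner_right]
    simp [PiLp.inner_apply, one]
  have : Fact (Module.finrank ℝ (EuclideanSpace ℝ (Fin (m + 1))) = m + 1) := ⟨by simp⟩
  exact ⟨_, (isBlockFrame_orthogonalProjectionOnto (β := fun _ => ()) hp).map
    (OrthonormalBasis.fromOrthogonalSpanSingleton (𝕜 := ℝ) m hone).repr⟩

namespace IsBlockFrame

variable {V E : Type*} [Fintype V] [NormedAddCommGroup E] [InnerProductSpace ℝ E] {ψ : V → E}

theorem inner_eq [DecidableEq V] (h : IsBlockFrame (fun _ => ()) ψ) (u v : V) :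
    ⟪ψ u, ψ v⟫ = (if u = v then 1 else 0) - (Fintype.card V : ℝ)⁻¹ := by
  have : Nonempty V := ⟨v⟩
  have hcard : (Fintype.card V : ℝ) ≠ 0 := by positivity
  have hsum : ∑ w, ⟪ψ u, ψ v - ψ w⟫ = Fintype.card V * ⟪ψ u, ψ v⟫ := by
    rw [← inner_sum, Finset.sum_sub_distrib, h.sum_eq_zero, sub_zero, Finset.sum_const,
      Finset.card_univ, ← Nat.cast_smul_eq_nsmul ℝ, inner_smul_right]
  simp_rw [h.inner_sub rfl, Finset.sum_sub_distrib] at hsum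
  have hmul : Fintype.card V * ⟪ψ u, ψ v⟫ = Fintype.card V * (if u = v then 1 else 0) - 1 := by
    simpa using hsum.symm
  rw [← mul_right_inj' hcard, hmul, mul_sub, mul_inv_cancel₀ hcard]

theorem affineIndependent (h : IsBlockFrame (fun _ => ()) ψ) : AffineIndependent ℝ ψ := by
  refine (affineIndependent_iff_of_fintype ℝ ψ).2 fun c hc hcψ v => ?_
  rw [Finset.univ.weightedVSub_eq_linear_combination hc] at hcψ
  have hconst : ∀ u, c u = c v := fun u => h.eq_of_sum_smul_eq_zero hcψ rfl
  have : Nonempty V := ⟨v⟩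
  simpa [hconst] using hc

theorem dist_eq_sqrt_two (h : IsBlockFrame (fun _ => ()) ψ) {u v : V} (huv : u ≠ v) :
    dist (ψ u) (ψ v) = √2 := by
  classical
  rw [dist_eq_norm, norm_eq_sqrt_real_inner, inner_sub_left, h.inner_sub rfl, h.inner_sub rfl]
  norm_num [huv, huv.symm]

theorem mem_convexHull_iff [Nonempty V] (h : IsBlockFrame (fun _ => ()) ψ) {x : E} :
    x ∈ convexHull ℝ (Set.range ψ) ↔ ∀ v, -(Fintype.card V : ℝ)⁻¹ ≤ ⟪ψ v, x⟫ := by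
  classical
  refine ⟨fun hx v => ?_, h.mem_convexHull⟩
  refine convexHull_min (Set.range_subset_iff.2 fun u => ?_)
    (convex_halfSpace_ge (innerₛₗ ℝ (ψ v)).isLinear _) hx
  change _ ≤ ⟪ψ v, ψ u⟫
  rw [h.inner_eq]
  split_ifs <;> linarith

theorem polarDual_range [Nonempty V] (h : IsBlockFrame (fun _ => ()) ψ) :
    polarDual (Set.range ψ) = -(Fintype.card V : ℝ) • convexHull ℝ (Set.range ψ) := by
  ext x
  have hcard : 0 < (Fintype.card V : ℝ) := by positivity
  rw [mem_polarDual_range, Set.mem_smul_set_iff_inv_smul_mem₀ (neg_ne_zero.2 hcard.ne'),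
    h.mem_convexHull_iff]
  refine forall_congr' fun v => ?_
  rw [inner_smul_right, inv_neg, neg_mul, neg_le_neg_iff, inv_mul_le_iff₀ hcard,
    mul_inv_cancel₀ hcard.ne']

end IsBlockFrame

theorem IsBlockFrame.exists_equilateral {m : ℕ} {E : Type*} [NormedAddCommGroup E]
    [InnerProductSpace ℝ E] {ψ : Fin (m + 1) → E} (h : IsBlockFrame (fun _ => ()) ψ) :
    ∃ Δ : Affine.Simplex ℝ E m, Δ.Equilateral ∧
      polarDual (Set.range ψ) = convexHull ℝ (Set.range Δ.points) := by
  let c : ℝˣ := Units.mk0 (-(Fintype.card (Fin (m + 1)) : ℝ)) 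
    (neg_ne_zero.2 (Nat.cast_ne_zero.2 Fintype.card_ne_zero))
  refine ⟨⟨c • ψ, h.affineIndependent.smul⟩, ⟨‖(c : ℝ)‖ * √2, fun u v huv => ?_⟩, ?_⟩
  · exact (dist_smul₀ (c : ℝ) _ _).trans (by rw [h.dist_eq_sqrt_two huv])
  · rw [h.polarDual_range, ← convexHull_smul, Set.smul_set_range]
    rfl

section Product

variable {ι : Type*} {J κ E : ι → Type*} [Fintype ι] [DecidableEq ι]
  [∀ i, NormedAddCommGroup (E i)] [∀ i, InnerProductSpace ℝ (E i)]

theorem inner_piLp_single_left (i : ι) (a : E i) (x : PiLp 2 E) :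
    ⟪PiLp.single 2 i a, x⟫ = ⟪a, x i⟫ := by
  rw [PiLp.inner_apply, Fintype.sum_eq_single i, PiLp.single_eq_same]
  intro j hj
  rw [PiLp.single_eq_of_ne 2 hj, inner_zero_left]

theorem mem_polarDual_range_single {ψ : ∀ i, J i → E i} {y : PiLp 2 E} :
    y ∈ polarDual (Set.range fun p : Σ i, J i => PiLp.single 2 p.1 (ψ p.1 p.2)) ↔
      ∀ i, y i ∈ polarDual (Set.range (ψ i)) := by
  simp_rw [mem_polarDual_range, inner_piLp_single_left, Sigma.forall]

theorem IsBlockFrame.sigma [∀ i, Fintype (J i)] [∀ i, DecidableEq (κ i)] {β : ∀ i, J i → κ i}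
    {ψ : ∀ i, J i → E i} (h : ∀ i, IsBlockFrame (β i) (ψ i)) :
    IsBlockFrame (Sigma.map id β) fun p : Σ i, J i => PiLp.single 2 p.1 (ψ p.1 p.2) := by
  have sum_fiber_sigma : ∀ (y : (Σ i, J i) → ℝ) (p : Σ i, J i),
      ∑ q with Sigma.map id β q = Sigma.map id β p, y q =
        ∑ j with β p.1 j = β p.1 p.2, y ⟨p.1, j⟩ := by
    rintro y ⟨i, j⟩
    rw [Finset.sum_filter, Fintype.sum_sigma, Fintype.sum_eq_single i, Finset.sum_filter]
    · simp [Sigma.map]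
    · intro k hk
      simp [Sigma.map, hk]
  refine ⟨fun p => ext_inner_right ℝ fun x => ?_, fun y hy => ?_,
    fun x => ext_inner_right ℝ fun z => ?_⟩
  · simp_rw [sum_inner, inner_piLp_single_left, sum_fiber_sigma, ← sum_inner, (h _).sum_fiber,
      inner_zero_left]
  · simp_rw [sum_fiber_sigma] at hy
    choose x hx using fun i => (h i).exists_inner_eq (fun j => y ⟨i, j⟩) fun j => hy ⟨i, j⟩
    exact ⟨WithLp.toLp 2 x, fun p => by rw [inner_piLp_single_left, hx]⟩
  · simp_rw [sum_inner, inner_smul_left, inner_piLp_single_left, Fintype.sum_sigma,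
      ← inner_smul_left, ← sum_inner, (h _).sum_inner_smul, PiLp.inner_apply]

end Product

theorem exists_isBlockFrame_sigma {t : ℕ} {m : Fin t → ℕ} [Nonempty (Σ i, Fin (m i + 1))]
    (hm : ∀ i, 0 < m i) :
    ∃ χ : (Σ i, Fin (m i + 1)) → EuclideanSpace ℝ (Fin (∑ i, m i)),
      IsBlockFrame Sigma.fst χ ∧ IsPolarDualOfSimplexProduct (convexHull ℝ (Set.range χ)) := by
  choose ψ hψ using fun i => exists_isBlockFrame_unit (m i)
  choose Δ hΔ hpolar using fun i => (hψ i).exists_equilateral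
  have hrank : Module.finrank ℝ (PiLp 2 fun i => EuclideanSpace ℝ (Fin (m i))) = ∑ i, m i := by
    rw [(WithLp.linearEquiv 2 ℝ (∀ i, EuclideanSpace ℝ (Fin (m i)))).finrank_eq,
      Module.finrank_pi_fintype]
    simp
  let e : EuclideanSpace ℝ (Fin (∑ i, m i)) ≃ₗᵢ[ℝ] PiLp 2 fun i => EuclideanSpace ℝ (Fin (m i)) :=
    ((stdOrthonormalBasis ℝ _).reindex (finCongr hrank)).repr.symm
  have hχ := ((IsBlockFrame.sigma hψ).map e.symm).comp_equiv (.refl _) (γ := Sigma.fst)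
    (by simp [Sigma.map, Sigma.ext_iff])
  refine ⟨_, hχ, hχ.zero_mem_interior, t, m, Δ, e, fun i => ⟨hm i, hΔ i⟩, ?_⟩
  rw [polarDual_convexHull, image_polarDual, ← Set.range_comp]
  ext x
  simp_rw [Set.mem_ofPred_eq, ← hpolar, ← mem_polarDual_range_single]
  simp [Function.comp_def]

theorem exists_equiv_sigma_fin {V ι : Type*} [Finite V] {β : V → ι} (hβ : Function.Surjective β)
    (hne : ∀ v, ∃ u ≠ v, β u = β v) :
    ∃ m : ι → ℕ, (∀ i, 0 < m i) ∧ ∃ f : V ≃ Σ i, Fin (m i + 1), ∀ v, (f v).1 = β v := by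
  have hcard : ∀ i, 1 < Nat.card {v // β v = i} := fun i => by
    obtain ⟨v, rfl⟩ := hβ i
    obtain ⟨u, huv, hu⟩ := hne v
    exact Finite.one_lt_card_iff_nontrivial.2 ⟨⟨u, hu⟩, ⟨v, rfl⟩, by simpa using huv⟩
  refine ⟨fun i => Nat.card {v // β v = i} - 1, fun i => Nat.sub_pos_of_lt (hcard i),
    (Equiv.sigmaFiberEquiv β).symm.trans (Equiv.sigmaCongrRight fun i =>
      Finite.equivFinOfCardEq (Nat.sub_add_cancel (hcard i).le).symm), fun v => rfl⟩

theorem exists_isBlockFrame {V : Type*} [Fintype V] [Nonempty V] {n t : ℕ} {β : V → Fin t}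
    (hβ : Function.Surjective β) (hne : ∀ v, ∃ u ≠ v, β u = β v) (hcard : Nat.card V = n + t) :
    ∃ φ : V → EuclideanSpace ℝ (Fin n), IsBlockFrame β φ ∧
      IsPolarDualOfSimplexProduct (convexHull ℝ (Set.range φ)) := by
  obtain ⟨m, hm, f, hf⟩ := exists_equiv_sigma_fin hβ hne
  have hsum : ∑ i, (m i + 1) = n + t := by
    rw [← hcard, Nat.card_congr f]
    simp
  obtain rfl : n = ∑ i, m i := by
    rw [Finset.sum_add_distrib] at hsum
    simpa using hsum.symm
  have : Nonempty (Σ i, Fin (m i + 1)) := .map f ‹_›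
  obtain ⟨χ, hχ, hpolar⟩ := exists_isBlockFrame_sigma hm
  refine ⟨χ ∘ f, hχ.comp_equiv f fun u v => by rw [hf, hf], ?_⟩
  rwa [f.surjective.range_comp]

end Existence

theorem proposition2p6 {V : Type*} (K : AbstractSimplicialComplex V) (n : ℕ)
    (hK : IsType34 K n) :
    ∃ φ : V → EuclideanSpace ℝ (Fin (n + 1)),
      IsPolytopalRealization K φ ∧
      (∃ Φ : isometryGroupOf (convexHull ℝ (Set.range φ)) ≃* autGroup K,
        ∀ (g : isometryGroupOf (convexHull ℝ (Set.range φ))) (v : V),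
          (g : EuclideanSpace ℝ (Fin (n + 1)) ≃ᵢ EuclideanSpace ℝ (Fin (n + 1))) (φ v) =
            φ ((Φ g : Equiv.Perm V) v)) ∧
      IsPolarDualOfSimplexProduct (convexHull ℝ (Set.range φ)) := by
  classical
  obtain ⟨t, β, hβ, hjoin, hcard⟩ := hK.exists_isBoundaryJoin
  obtain ⟨_, _⟩ := Nat.card_pos_iff.1 (show 0 < Nat.card V by omega)
  have := Fintype.ofFinite V
  obtain ⟨φ, hφ, hpolar⟩ := exists_isBlockFrame hβ hjoin.exists_ne hcard
  have hreal := hφ.isPolytopalRealization hjoin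
  exact ⟨φ, hreal, hreal.exists_mulEquiv fun σ hσ => hφ.exists_isometryEquiv hjoin hσ, hpolar⟩
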